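/- Fix a prime $p$. For a ring $R$ let $R^\flat=\varprojlim_{F}R/pR$ be its tilt. If $R$ is (classically) $p$-adically complete, the multiplicative monoid of $R^\flat$ is identified with the monoid of sequences $x=(x^{(n)})_{n\ge 0}$ in $R$ with $(x^{(n+1)})^p=x^{(n)}$, and one writes $x^\sharp=x^{(0)}$. For a subset $J$ of such an $R$ put $J^\flat=\{x\in R^\flat : x^{(n)}\in J \text{ for all } n\ge 0\}$. Perfectoid rings are those of Bhatt–Morrow–Scholze: $R$ is $\pi$-adically complete for some $\pi$ with $\pi^p\mid p$, Frobenius is surjective on $R/pR$, and the kernel of Fontaine's map $\theta_R\colon W(R^\flat)\to R$, $\sum_n [x_n]p^n\mapsto\sum_n x_n^\sharp p^n$, is principal. An ideal $J$ of a ring $R$ is called perfectoid if $R/J$ is a perfectoid ring. For a radical ideal $I$ of $R^\flat$, $R$ perfectoid, its untilt is $I^\sharp=\theta_R(W(I))$, where $W(I)=\{\sum_n[x_n]p^n : x_n\in I\}$. Finally $p^\flat$ denotes any element of $R^\flat$ such that $(p^\flat)^\sharp$ is a unit multiple of $p$ in $R$; an ideal is $a$-adically closed if it is closed in the $a$-adic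 topology of the ring. (1) Let $R$ be a $p$-adically complete ring and $J$ a $p$-adically closed ideal of $R$. Then $J^\flat$ is the kernel of the homomorphism $\varphi^\flat\colon R^\flat\to(R/J)^\flat$ corresponding to the quotient map $R\to R/J$. (2) Let $R$ be a perfectoid ring of characteristic $0$ and $J$ a perfectoid ideal of $R$. Then $J^\flat$ is an ideal and $\varphi^\flat$ induces an isomorphism $R^\flat/J^\flat\cong(R/J)^\flat$. (3) Let $R$ be a perfectoid ring and $J$ a perfectoid ideal of $R$. Then $J^\flat$ is a $p^\flat$-adically closed radical ideal of $R^\flat$. (4) Conversely, let $R$ be a perfectoid ring of characteristic $0$ and let $I$ be a $p^\flat$-adically closed radical ideal of $R^\flat$. Then $I$ is a perfectoid ideal of $R^\flat$, and $I^\sharp$ is a perfectoid ideal of $R$. -/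

import Mathlib

namespace Perfd

noncomputable section

universe u v

/-- The additivity of the `p`-th power map on a ring in which `p = 0` (the zero ring included). -/
theorem add_pow_of_natCast_eq_zero {p : ℕ} (hp : p.Prime) {A : Type u} [CommRing A]
    (h : (p : A) = 0) (a b : A) : (a + b) ^ p = a ^ p + b ^ p := by
  obtain ⟨r, hr⟩ := exists_add_pow_prime_eq hp a b
  rw [hr, h]
  ring

theorem natCast_modP (p : ℕ) (R : Type u) [CommRing R] : (p : ModP R p) = 0 := by
  have h : (Ideal.Quotient.mk (Ideal.span {(p : R)})) (p : R) = 0 :=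
    Ideal.Quotient.eq_zero_iff_mem.2 (Ideal.mem_span_singleton_self _)
  simpa using h

/-- A `p`-adically complete ring in which `p` is a unit is the zero ring. -/
theorem subsingleton_of_isUnit (p : ℕ) (R : Type u) [CommRing R]
    [IsAdicComplete (Ideal.span {(p : R)}) R] (h : IsUnit (p : R)) : Subsingleton R := by
  refine ⟨fun x y => ?_⟩
  rw [IsHausdorff.eq_iff_smodEq (I := Ideal.span {(p : R)})]
  intro n
  rw [Ideal.span_singleton_eq_top.2 h, Ideal.top_pow, smul_eq_mul, Ideal.mul_top]
  exact SModEq.top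

variable (p : ℕ) [hp : Fact p.Prime] (R : Type u) [CommRing R]

/-- The sequences `(x₀, x₁, …)` in `R / pR` with `xₙ₊₁ ^ p = xₙ`, as a subring. -/
def tiltSubring : Subring (ℕ → ModP R p) where
  carrier := {x | ∀ n, x (n + 1) ^ p = x n}
  one_mem' _ := one_pow _
  mul_mem' {x y} hx hy n := by
    simp only [Pi.mul_apply, mul_pow, hx n, hy n]
  zero_mem' _ := zero_pow hp.1.ne_zero
  add_mem' {x y} hx hy n := by
    simp only [Pi.add_apply, add_pow_of_natCast_eq_zero hp.1 (natCast_modP p R), hx n, hy n]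
  neg_mem' {x} hx n := by
    have h := add_pow_of_natCast_eq_zero hp.1 (natCast_modP p R) (x (n + 1)) (-x (n + 1))
    rw [add_neg_cancel, zero_pow hp.1.ne_zero, hx n] at h
    simp only [Pi.neg_apply]
    exact (neg_eq_of_add_eq_zero_right h.symm).symm

/-- The tilt `R^♭ = lim (R / pR)` along Frobenius. When `p` is not a unit of `R`, this is
Mathlib's `PreTilt R p` (see `tiltEquivPreTilt`); here the zero ring is allowed as well. -/
abbrev Tilt : Type u := tiltSubring p R

variable {R}

/-- The map `R / pR → S / pS` induced by a ring homomorphism `R → S`. -/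
def modPMap {S : Type v} [CommRing S] (f : R →+* S) : ModP R p →+* ModP S p :=
  Ideal.quotientMap (Ideal.span {(p : S)}) f <| by
    rw [Ideal.span_singleton_le_iff_mem, Ideal.mem_comap, map_natCast]
    exact Ideal.mem_span_singleton_self _

/-- The homomorphism `f^♭ : R^♭ → S^♭` corresponding to `f : R → S`. -/
def tiltMap {S : Type v} [CommRing S] (f : R →+* S) : Tilt p R →+* Tilt p S where
  toFun x := ⟨fun n => modPMap p f (x.1 n), fun n => by rw [← map_pow, x.2 n]⟩
  map_one' := Subtype.ext <| funext fun _ => map_one (modPMap p f)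
  map_mul' x y := Subtype.ext <| funext fun n => map_mul (modPMap p f) (x.1 n) (y.1 n)
  map_zero' := Subtype.ext <| funext fun _ => map_zero (modPMap p f)
  map_add' x y := Subtype.ext <| funext fun n => map_add (modPMap p f) (x.1 n) (y.1 n)

variable (R)

/-- Termwise reduction modulo `p`, from the sequences in `R` with `yₙ₊₁ ^ p = yₙ` to `R^♭`. -/
def tiltReduce : Perfection R p →* Tilt p R where
  toFun y := ⟨fun n => Ideal.Quotient.mk _ (Perfection.coeffMonoidHom R p n y), fun n => by
    rw [← map_pow, Perfection.coeffMonoidHom_pow_p']⟩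
  map_one' := Subtype.ext <| funext fun n => by simp
  map_mul' x y := Subtype.ext <| funext fun n => by simp

/-- The comparison with Mathlib's tilt, which is defined when `p` is not a unit of `R`. -/
def tiltEquivPreTilt [Fact ¬IsUnit (p : R)] : Tilt p R ≃+* PreTilt R p where
  toFun x := ⟨x.1, x.2⟩
  invFun x := ⟨x.1, x.2⟩
  left_inv _ := rfl
  right_inv _ := rfl
  map_mul' _ _ := rfl
  map_add' _ _ := rfl

section Complete

variable [IsAdicComplete (Ideal.span {(p : R)}) R]

theorem tiltReduce_bijective : Function.Bijective (tiltReduce p R) := by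
  by_cases h : IsUnit (p : R)
  · have := subsingleton_of_isUnit p R h
    have : Subsingleton (ModP R p) := Ideal.Quotient.mk_surjective.subsingleton
    exact ⟨fun x y _ => Perfection.extMonoid fun n => Subsingleton.elim _ _,
      fun x => ⟨1, Subsingleton.elim _ _⟩⟩
  · have : Fact ¬IsUnit (p : R) := ⟨h⟩
    exact (Perfection.quotientMulEquiv p (Ideal.span {(p : R)})).bijective

/-- The identification of the multiplicative monoid of `R^♭` with the sequences
`(x⁽⁰⁾, x⁽¹⁾, …)` in `R` such that `(x⁽ⁿ⁺¹⁾) ^ p = x⁽ⁿ⁾`, for a `p`-adically complete ring `R`. -/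
def tiltEquiv : Tilt p R ≃* Perfection R p :=
  (MulEquiv.ofBijective (tiltReduce p R) (tiltReduce_bijective p R)).symm

variable {R}

/-- The `n`-th term `x⁽ⁿ⁾ ∈ R` of an element `x` of `R^♭`. -/
def term (n : ℕ) (x : Tilt p R) : R := Perfection.coeffMonoidHom R p n (tiltEquiv p R x)

/-- `x^♯ = x⁽⁰⁾`. -/
def sharp (x : Tilt p R) : R := term p 0 x

variable (R)

open Classical in
/-- Fontaine's map `θ_R : W(R^♭) → R`, `∑ [xₙ] pⁿ ↦ ∑ xₙ^♯ pⁿ`, for a `p`-adically complete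
ring `R`. If `p` is a unit, then `R` is the zero ring. -/
def theta : WittVector p (Tilt p R) →+* R :=
  if h : IsUnit (p : R) then
    { toFun := fun _ => 0
      map_one' := @Subsingleton.elim _ (subsingleton_of_isUnit p R h) _ _
      map_mul' := fun _ _ => (mul_zero 0).symm
      map_zero' := rfl
      map_add' := fun _ _ => (add_zero 0).symm }
  else
    haveI : Fact ¬IsUnit (p : R) := ⟨h⟩
    (WittVector.fontaineTheta R p).comp (WittVector.map (tiltEquivPreTilt p R : _ →+* _))

theorem theta_teichmuller (x : Tilt p R) :
    theta p R (WittVector.teichmuller p x) = sharp p x := by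
  by_cases h : IsUnit (p : R)
  · exact @Subsingleton.elim _ (subsingleton_of_isUnit p R h) _ _
  · have hF : Fact ¬IsUnit (p : R) := ⟨h⟩
    obtain ⟨y, rfl⟩ := (tiltReduce_bijective p R).2 x
    have h1 : sharp p (tiltReduce p R y) = Perfection.coeffMonoidHom R p 0 y :=
      congrArg (Perfection.coeffMonoidHom R p 0)
        ((MulEquiv.ofBijective (tiltReduce p R) (tiltReduce_bijective p R)).symm_apply_apply y)
    rw [h1, theta, dif_neg h, RingHom.comp_apply, WittVector.map_teichmuller,
      WittVector.fontaineTheta_teichmuller]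
    exact Perfection.teichmuller₀_mapMonoidHom_idealQuotientMk

end Complete

/-- Perfectoid rings: `R` is `π`-adically complete for some `π` such that `π ^ p` divides `p`,
Frobenius is surjective on `R / pR`, and the kernel of `θ_R` is principal. The `p`-adic
completeness, which follows from the first condition, is recorded because `θ_R` needs it. -/
structure IsPerfectoid : Prop where
  exists_complete : ∃ π : R, π ^ p ∣ (p : R) ∧ IsAdicComplete (Ideal.span {π}) R
  frobenius_surjective : Function.Surjective fun x : ModP R p => x ^ p
  [complete : IsAdicComplete (Ideal.span {(p : R)}) R]
  ker_theta_principal : (RingHom.ker (theta p R)).IsPrincipal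

variable {R}

/-- An ideal `J` is perfectoid if the quotient ring by `J` is perfectoid. -/
def IsPerfectoidIdeal (J : Ideal R) : Prop := IsPerfectoid p (R ⧸ J)

/-- `J` is closed in the `a`-adic topology. -/
def IsAdicallyClosed (a : R) (J : Ideal R) : Prop :=
  @IsClosed R (Ideal.span {a}).adicTopology (J : Set R)

section Complete

variable [IsAdicComplete (Ideal.span {(p : R)}) R]

/-- `J^♭ = {x ∈ R^♭ | x⁽ⁿ⁾ ∈ J for all n}`. -/
def tilt (J : Set R) : Set (Tilt p R) := {x | ∀ n, term p n x ∈ J}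

/-- `W(I) = {∑ [xₙ] pⁿ | xₙ ∈ I}`, the sum being the `p`-adic limit of its partial sums. -/
def wittSet {A : Type u} [CommRing A] (I : Set A) : Set (WittVector p A) :=
  {w | ∃ x : ℕ → A, (∀ n, x n ∈ I) ∧ ∀ N : ℕ,
    (p : WittVector p A) ^ N ∣
      w - ∑ n ∈ Finset.range N, WittVector.teichmuller p (x n) * (p : WittVector p A) ^ n}

/-- `I^♯ = θ_R(W(I))`. -/
def untilt (I : Set (Tilt p R)) : Set R := theta p R '' wittSet p I

end Complete

end

end Perfd

/-! Write `A` for the tilt of `R`. If `φ^♭(x) = 0`, then `x⁽ⁿ⁺ᵏ⁾` lies in `J + pR`, so its `p^k`-th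
power `x⁽ⁿ⁾` lies in `J + p^k R` for all `k`; closedness of `J` gives (1) (`tilt_eq_ker_tiltMap`).
For `R` perfectoid, `ker θ` is generated by some `[ϖ] - pu` with `u` a unit
(`IsPerfectoid.exists_ker_theta_eq_span`). Hence the kernel of `A → R/p` is `(ϖ)`, and the inverse
limit topology of `A` is the `ϖ`-adic one. Surjectivity of `φ^♭` can then be checked modulo `ϖ`,
which gives (2). Tilts are reduced and `ϖ`-adically separated, so kernels into them are radical and
closed, which gives (3). For (4), `A/I` is perfect, hence perfectoid, and `W(I)` is the kernel of
`W(A) → W(A/I)`. Thus `R/I^♯` is `W(A/I)/([ϖ] - pu)`. It is `p`-adically separated because `A/I` is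
reduced (`distinguished_dvd_of_forall`), and the kernel of its `θ` is generated by the image of `[ϖ]
- pu`, because `A` surjects onto its tilt. -/

namespace Perfd

noncomputable section

universe u v

/-! ### Principal adic topologies in terms of divisibility. -/

section Adic

variable {R : Type u} [CommRing R]

theorem smodEq_span_singleton_pow_iff {a : R} {n : ℕ} {x y : R} :
    x ≡ y [SMOD (Ideal.span {a} ^ n • ⊤ : Submodule R R)] ↔ a ^ n ∣ x - y := by
  rw [SModEq.sub_mem, smul_eq_mul, Ideal.mul_top, Ideal.span_singleton_pow,
    Ideal.mem_span_singleton]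

theorem isHausdorff_span_singleton_iff {a : R} :
    IsHausdorff (Ideal.span {a}) R ↔ ∀ x : R, (∀ n : ℕ, a ^ n ∣ x) → x = 0 := by
  simp only [isHausdorff_iff, smodEq_span_singleton_pow_iff, sub_zero]

theorem pow_dvd_sub_of_le {a : R} {f : ℕ → R} (hf : ∀ n, a ^ n ∣ f (n + 1) - f n) {m n : ℕ}
    (hmn : m ≤ n) : a ^ m ∣ f n - f m := by
  induction n, hmn using Nat.le_induction with
  | base => simp
  | succ n hmn ih =>
    rw [← sub_add_sub_cancel]
    exact dvd_add ((pow_dvd_pow a hmn).trans (hf n)) ih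

theorem isPrecomplete_span_singleton_iff {a : R} :
    IsPrecomplete (Ideal.span {a}) R ↔ ∀ f : ℕ → R, (∀ n, a ^ n ∣ f (n + 1) - f n) →
      ∃ L : R, ∀ n, a ^ n ∣ L - f n := by
  simp only [isPrecomplete_iff, smodEq_span_singleton_pow_iff]
  constructor
  · intro h f hf
    obtain ⟨L, hL⟩ := h f fun hmn => (dvd_sub_comm).1 (pow_dvd_sub_of_le hf hmn)
    exact ⟨L, fun n => dvd_sub_comm.1 (hL n)⟩
  · intro h f hf
    obtain ⟨L, hL⟩ := h f fun n => dvd_sub_comm.1 (hf n.le_succ)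
    exact ⟨L, fun n => dvd_sub_comm.1 (hL n)⟩

theorem isUnit_add_of_dvd {a : R} [IsAdicComplete (Ideal.span {a}) R] {x y : R} (hx : IsUnit x)
    (hy : a ∣ y) : IsUnit (x + y) := by
  obtain ⟨u, rfl⟩ := hx
  have hy' : y ∈ Ideal.jacobson (⊥ : Ideal R) :=
    IsAdicComplete.le_jacobson_bot (Ideal.span {a}) (Ideal.mem_span_singleton.2 hy)
  have h := Ideal.mem_jacobson_bot.1 hy' (↑u⁻¹ : R)
  have : (u : R) + y = u * (y * ↑u⁻¹ + 1) := by
    rw [mul_add, mul_one, mul_left_comm, Units.mul_inv, mul_one, add_comm]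
  rw [this]
  exact u.isUnit.mul h

/-- Adic completeness with respect to `b` passes to a root of a unit multiple of `b`. -/
theorem isAdicComplete_of_pow_eq {a b : R} {k : ℕ} (hk : k ≠ 0) (v : Rˣ) (hab : a ^ k = v * b)
    (h : IsAdicComplete (Ideal.span {b}) R) : IsAdicComplete (Ideal.span {a}) R := by
  have h1 : ∀ n x, a ^ (k * n) ∣ x ↔ b ^ n ∣ x := fun n x => by
    rw [pow_mul, hab, mul_pow]
    exact (v.isUnit.pow n).mul_left_dvd
  have hn : ∀ n, n ≤ k * n := fun n => Nat.le_mul_of_pos_left n (Nat.pos_of_ne_zero hk)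
  have hH := isHausdorff_span_singleton_iff.1 h.toIsHausdorff
  have hP := isPrecomplete_span_singleton_iff.1 h.toIsPrecomplete
  refine @IsAdicComplete.mk _ _ _ _ _ _ (isHausdorff_span_singleton_iff.2 fun x hx => ?_)
    (isPrecomplete_span_singleton_iff.2 fun f hf => ?_)
  · exact hH x fun n => (h1 n x).1 (hx _)
  -- The subsequence `f (k * n)` is Cauchy for `b`, and its limit is also the `a`-adic limit of `f`.
  · obtain ⟨L, hL⟩ := hP (fun n => f (k * n)) fun n =>
      (h1 n _).1 (pow_dvd_sub_of_le hf (Nat.mul_le_mul_left k n.le_succ))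
    refine ⟨L, fun n => ?_⟩
    rw [← sub_add_sub_cancel L (f (k * n))]
    exact dvd_add ((pow_dvd_pow a (hn n)).trans ((h1 n _).2 (hL n))) (pow_dvd_sub_of_le hf (hn n))

/-- Lifting the quotients `c n` of the increments, rather than the terms, makes the lifted sequence
Cauchy. -/
theorem isPrecomplete_of_surjective {S : Type v} [CommRing S] {f : R →+* S}
    (hf : Function.Surjective f) {a : R} (h : IsPrecomplete (Ideal.span {a}) R) :
    IsPrecomplete (Ideal.span {f a}) S := by
  have hP := isPrecomplete_span_singleton_iff.1 h
  refine isPrecomplete_span_singleton_iff.2 fun g hg => ?_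
  choose c hc using hg
  choose c' hc' using fun n => hf (c n)
  obtain ⟨g0, hg0⟩ := hf (g 0)
  have hs : ∀ n, f (g0 + ∑ i ∈ Finset.range n, a ^ i * c' i) = g n := by
    intro n
    induction n with
    | zero => simpa using hg0
    | succ n ih =>
      rw [Finset.sum_range_succ, ← add_assoc, map_add, ih, map_mul, map_pow, hc', ← hc]
      ring
  obtain ⟨L, hL⟩ := hP (fun n => g0 + ∑ i ∈ Finset.range n, a ^ i * c' i) fun n => by
    rw [Finset.sum_range_succ]
    exact ⟨c' n, by ring⟩
  refine ⟨f L, fun n => ?_⟩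
  have := map_dvd f (hL n)
  rwa [map_sub, map_pow, hs] at this

theorem isAdicallyClosed_iff {a : R} {J : Ideal R} :
    IsAdicallyClosed a J ↔ ∀ x : R, (∀ n : ℕ, ∃ y ∈ J, a ^ n ∣ x - y) → x ∈ J := by
  let : TopologicalSpace R := (Ideal.span {a}).adicTopology
  have key : ∀ x : R, x ∈ closure (J : Set R) ↔ ∀ n : ℕ, ∃ y ∈ J, a ^ n ∣ x - y := by
    intro x
    rw [mem_closure_iff_nhds_basis ((Ideal.span {a}).hasBasis_nhds_adic x)]
    refine ⟨fun h n => ?_, fun h n _ => ?_⟩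
    · obtain ⟨y, hy, z, hz, rfl⟩ := h n trivial
      rw [Ideal.span_singleton_pow, SetLike.mem_coe, Ideal.mem_span_singleton] at hz
      exact ⟨_, hy, by simpa using hz⟩
    · obtain ⟨y, hy, hd⟩ := h n
      refine ⟨y, hy, y - x, ?_, by simp⟩
      rw [Ideal.span_singleton_pow, SetLike.mem_coe, Ideal.mem_span_singleton]
      exact dvd_sub_comm.1 hd
  constructor
  · intro h x hx
    have := (key x).2 hx
    rwa [IsClosed.closure_eq h] at this
  · intro h
    exact isClosed_of_closure_subset fun x hx => h x ((key x).1 hx)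

end Adic

/-! ### Perfect rings and their Witt vectors. -/

variable (p : ℕ) [hp : Fact p.Prime]

/-- Perfect rings of characteristic `p`, the zero ring included. -/
structure IsPerfectOfCharP (A : Type u) [CommRing A] : Prop where
  natCast_eq_zero : (p : A) = 0
  bijective_pow : Function.Bijective fun x : A => x ^ p

namespace IsPerfectOfCharP

variable {p} {A : Type u} [CommRing A] (hA : IsPerfectOfCharP p A)
include hA

/-- The zero ring, which occurs as the quotient by the unit ideal, does not satisfy `CharP A p`, so
it is split off. -/
theorem subsingleton_or : Subsingleton A ∨ ∃ _ : CharP A p, PerfectRing A p := by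
  rcases subsingleton_or_nontrivial A with h | h
  · exact Or.inl h
  · have hc : CharP A p := (CharP.charP_iff_prime_eq_zero hp.1).2 hA.natCast_eq_zero
    exact Or.inr ⟨hc, ⟨hA.bijective_pow⟩⟩

omit hp in
theorem bijective_pow_pow (n : ℕ) : Function.Bijective fun x : A => x ^ p ^ n := by
  induction n with
  | zero =>
    simp only [pow_zero, pow_one]
    exact Function.bijective_id
  | succ n ih =>
    have : (fun x : A => x ^ p ^ (n + 1)) = (fun x => x ^ p) ∘ fun x => x ^ p ^ n := by
      funext x
      simp [pow_succ, pow_mul]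
    rw [this]
    exact hA.bijective_pow.comp ih

theorem eq_zero_of_pow_eq_zero {x : A} {n : ℕ} (h : x ^ p ^ n = 0) : x = 0 := by
  apply (hA.bijective_pow_pow n).1
  simp only [h]
  rw [zero_pow (pow_ne_zero _ hp.1.ne_zero)]

/-- Reducedness: `(a * x) ^ p` is a multiple of `a ^ 2 * x` because `p ≥ 2`. This is what bounds the
torsion of `W(A) / ([a] - pu)`. -/
theorem mul_eq_zero_of_sq_mul_eq_zero {a x : A} (h : a ^ 2 * x = 0) : a * x = 0 := by
  apply hA.eq_zero_of_pow_eq_zero (n := 1)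
  obtain ⟨k, hk⟩ := Nat.exists_eq_add_of_le hp.1.two_le
  have : (a * x) ^ p = (a ^ 2 * x) * (a ^ k * x ^ (1 + k)) := by
    rw [hk]
    ring
  rw [pow_one, this, h, zero_mul]

theorem quotient {I : Ideal A} (hI : I.IsRadical) : IsPerfectOfCharP p (A ⧸ I) where
  natCast_eq_zero := by
    rw [← map_natCast (Ideal.Quotient.mk I), hA.natCast_eq_zero, map_zero]
  bijective_pow := by
    have h0 : (p : A ⧸ I) = 0 := by
      rw [← map_natCast (Ideal.Quotient.mk I), hA.natCast_eq_zero, map_zero]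
    refine ⟨fun x y hxy => ?_, fun x => ?_⟩
    · have h1 : (x - y) ^ p = 0 := by
        have := add_pow_of_natCast_eq_zero hp.1 h0 (x - y) y
        rw [sub_add_cancel] at this
        simp only at hxy
        rw [hxy] at this
        simpa using this.symm
      obtain ⟨z, hz⟩ := Ideal.Quotient.mk_surjective (x - y)
      rw [← hz, ← map_pow, Ideal.Quotient.eq_zero_iff_mem] at h1
      have := Ideal.Quotient.eq_zero_iff_mem.2 (hI ⟨p, h1⟩)
      rw [hz] at this
      exact sub_eq_zero.1 this
    · obtain ⟨z, rfl⟩ := Ideal.Quotient.mk_surjective x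
      obtain ⟨y, rfl⟩ := hA.bijective_pow.2 z
      exact ⟨Ideal.Quotient.mk I y, by simp⟩

theorem natCast_dvd_iff {w : WittVector p A} : (p : WittVector p A) ∣ w ↔ w.coeff 0 = 0 := by
  rcases hA.subsingleton_or with h | ⟨_, _⟩
  · have : Subsingleton (WittVector p A) := ⟨fun x y => WittVector.ext fun n => Subsingleton.elim _ _⟩
    exact ⟨fun _ => Subsingleton.elim _ _, fun _ => ⟨0, Subsingleton.elim _ _⟩⟩
  · rw [← Ideal.mem_span_singleton, WittVector.mem_span_p_iff_coeff_zero_eq_zero]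

theorem coeff_zero_natCast_mul (w : WittVector p A) : ((p : WittVector p A) * w).coeff 0 = 0 :=
  hA.natCast_dvd_iff.1 (dvd_mul_right _ _)

theorem eq_zero_of_natCast_mul {w : WittVector p A} (h : (p : WittVector p A) * w = 0) :
    w = 0 := by
  rcases hA.subsingleton_or with _ | ⟨_, _⟩
  · exact WittVector.ext fun n => Subsingleton.elim _ _
  · exact WittVector.eq_zero_of_p_mul_eq_zero w (by rwa [mul_comm])

theorem natCast_mul_cancel {w w' : WittVector p A}
    (h : (p : WittVector p A) * w = (p : WittVector p A) * w') : w = w' :=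
  sub_eq_zero.1 (hA.eq_zero_of_natCast_mul (by rw [mul_sub, h, sub_self]))

theorem isAdicComplete : IsAdicComplete (Ideal.span {(p : WittVector p A)}) (WittVector p A) := by
  rcases hA.subsingleton_or with _ | ⟨_, _⟩
  · have : Subsingleton (WittVector p A) := ⟨fun x y => WittVector.ext fun n => Subsingleton.elim _ _⟩
    exact {}
  · infer_instance

/-- One digit of the Teichmüller expansion; iterating it replaces manipulation of infinite sums. -/
theorem exists_eq_teichmuller_add (w : WittVector p A) :
    ∃ w', w = WittVector.teichmuller p (w.coeff 0) + (p : WittVector p A) * w' := by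
  have h : (w - WittVector.teichmuller p (w.coeff 0)).coeff 0 = 0 := by
    have := map_sub (WittVector.constantCoeff (p := p) (R := A)) w
      (WittVector.teichmuller p (w.coeff 0))
    simpa [WittVector.constantCoeff] using this
  obtain ⟨w', h'⟩ := hA.natCast_dvd_iff.2 h
  exact ⟨w', by rw [← h']; ring⟩

theorem isUnit_of_coeff_zero {w : WittVector p A} (h : IsUnit (w.coeff 0)) : IsUnit w := by
  obtain ⟨w', hw⟩ := hA.exists_eq_teichmuller_add w
  have := hA.isAdicComplete
  rw [hw]
  exact isUnit_add_of_dvd (h.map (WittVector.teichmuller p)) (dvd_mul_right _ _)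

end IsPerfectOfCharP

theorem coeff_zero_add {A : Type u} [CommRing A] (x y : WittVector p A) :
    (x + y).coeff 0 = x.coeff 0 + y.coeff 0 :=
  map_add (WittVector.constantCoeff (p := p) (R := A)) x y

theorem coeff_zero_neg {A : Type u} [CommRing A] (x : WittVector p A) :
    (-x).coeff 0 = -x.coeff 0 :=
  map_neg (WittVector.constantCoeff (p := p) (R := A)) x

theorem coeff_zero_sub {A : Type u} [CommRing A] (x y : WittVector p A) :
    (x - y).coeff 0 = x.coeff 0 - y.coeff 0 :=
  map_sub (WittVector.constantCoeff (p := p) (R := A)) x y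

theorem coeff_zero_mul {A : Type u} [CommRing A] (x y : WittVector p A) :
    (x * y).coeff 0 = x.coeff 0 * y.coeff 0 :=
  map_mul (WittVector.constantCoeff (p := p) (R := A)) x y

/-- `W(I)` is the kernel of `W(A) → W(A / I)`. -/
theorem wittSet_eq_ker {A : Type u} [CommRing A] (hA : IsPerfectOfCharP p A) {I : Ideal A}
    (hI : I.IsRadical) : wittSet p (I : Set A) =
      (RingHom.ker (WittVector.map (p := p) (Ideal.Quotient.mk I)) : Set (WittVector p A)) := by
  have hB := hA.quotient hI
  have hH := isHausdorff_span_singleton_iff.1 hB.isAdicComplete.toIsHausdorff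
  ext w
  simp only [SetLike.mem_coe, RingHom.mem_ker, wittSet, Set.mem_ofPred_eq]
  constructor
  · rintro ⟨x, hx, hw⟩
    refine hH _ fun N => ?_
    have h := map_dvd (WittVector.map (p := p) (Ideal.Quotient.mk I)) (hw N)
    rw [map_pow, map_natCast, map_sub, map_sum, Finset.sum_eq_zero, sub_zero] at h
    · exact h
    · intro n _
      rw [map_mul, WittVector.map_teichmuller, Ideal.Quotient.eq_zero_iff_mem.2 (hx n),
        WittVector.teichmuller_zero, zero_mul]
  · intro hw
    choose g hg using hA.exists_eq_teichmuller_add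
    -- The successive tails stay in the kernel because `p` is a nonzerodivisor in `W(A / I)`.
    have hker : ∀ n, WittVector.map (p := p) (Ideal.Quotient.mk I) (g^[n] w) = 0 := by
      intro n
      induction n with
      | zero => exact hw
      | succ n ih =>
        have h := congrArg (WittVector.map (p := p) (Ideal.Quotient.mk I)) (hg (g^[n] w))
        have h0 : (Ideal.Quotient.mk I) ((g^[n] w).coeff 0) = 0 := by
          have := congrArg (fun z => z.coeff 0) ih
          simpa [WittVector.map_coeff] using this
        rw [ih, map_add, WittVector.map_teichmuller, h0, WittVector.teichmuller_zero, zero_add,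
          map_mul, map_natCast] at h
        rw [Function.iterate_succ_apply']
        exact hB.eq_zero_of_natCast_mul h.symm
    refine ⟨fun n => (g^[n] w).coeff 0, fun n => ?_, fun N => ⟨g^[N] w, ?_⟩⟩
    · have := congrArg (fun z => z.coeff 0) (hker n)
      simp only [WittVector.map_coeff, WittVector.zero_coeff] at this
      exact Ideal.Quotient.eq_zero_iff_mem.1 this
    · rw [sub_eq_iff_eq_add]
      induction N with
      | zero => simp
      | succ N ih =>
        have h := hg (g^[N] w)
        rw [Finset.sum_range_succ, Function.iterate_succ_apply']
        linear_combination ih + (p : WittVector p A) ^ N * h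

/-! ### Torsion and separatedness of `W(A) / ([a] - pu)`. -/

section Distinguished

variable {p} {A : Type u} [CommRing A] (hA : IsPerfectOfCharP p A) (a : A) {u : WittVector p A} (hu : IsUnit u)
include hA hu

/-- The `p`-power torsion of `W(A) / ([a] - pu)` is killed by `p`. -/
theorem distinguished_dvd_of_dvd_sq {w : WittVector p A}
    (h : WittVector.teichmuller p a - p * u ∣ (p : WittVector p A) ^ 2 * w) :
    WittVector.teichmuller p a - p * u ∣ p * w := by
  obtain ⟨c, hc⟩ := h
  obtain ⟨c', hc'⟩ := hA.exists_eq_teichmuller_add c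
  set c0 := c.coeff 0
  -- Reduction of `hc` modulo `p`.
  have h0 : a * c0 = 0 := by
    have h1 : a * c0 = (WittVector.teichmuller p a * c).coeff 0 := by
      rw [coeff_zero_mul, WittVector.teichmuller_coeff_zero]
    rw [h1, ← hA.natCast_dvd_iff]
    exact ⟨p * w + u * c, by linear_combination -hc⟩
  have hT : WittVector.teichmuller p a * WittVector.teichmuller p c0 = 0 := by
    rw [← map_mul, h0, WittVector.teichmuller_zero]
  -- Since `[a][c0] = 0`, every remaining term of `hc` carries a factor `p`, which cancels.
  have h2 : p * w = -(u * WittVector.teichmuller p c0) +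
      (WittVector.teichmuller p a - p * u) * c' := by
    apply hA.natCast_mul_cancel
    linear_combination hc + hT + (WittVector.teichmuller p a - p * u) * hc'
  have h3 : u.coeff 0 * c0 = a * c'.coeff 0 := by
    have h4 : (u * WittVector.teichmuller p c0 - WittVector.teichmuller p a * c').coeff 0 = 0 := by
      rw [← hA.natCast_dvd_iff]
      exact ⟨-w - u * c', by linear_combination h2⟩
    rw [coeff_zero_sub, coeff_zero_mul, coeff_zero_mul, WittVector.teichmuller_coeff_zero,
      WittVector.teichmuller_coeff_zero] at h4
    exact sub_eq_zero.1 h4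
  -- Multiplying `h3` by `a` gives `a ^ 2 * c'.coeff 0 = 0`; reducedness removes one `a`.
  have h5 : a * c'.coeff 0 = 0 := by
    apply hA.mul_eq_zero_of_sq_mul_eq_zero
    linear_combination -a * h3 + u.coeff 0 * h0
  have hu0 : IsUnit (u.coeff 0) :=
    hu.map (WittVector.constantCoeff (p := p) (R := A))
  have h6 : c0 = 0 := hu0.mul_right_eq_zero.1 (h3.trans h5)
  rw [h6, WittVector.teichmuller_zero, mul_zero, neg_zero, zero_add] at h2
  exact ⟨c', h2⟩

/-- The ideal generated by `[a] - pu` is `p`-adically closed in `W(A)`. -/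
theorem distinguished_dvd_of_forall {w : WittVector p A}
    (h : ∀ n : ℕ, ∃ b, WittVector.teichmuller p a - p * u ∣ w - (p : WittVector p A) ^ n * b) :
    WittVector.teichmuller p a - p * u ∣ w := by
  set ξ := WittVector.teichmuller p a - p * u with hξ
  choose b hb using h
  have tors : ∀ n x, ξ ∣ (p : WittVector p A) ^ (n + 1) * x → ξ ∣ p * x := by
    intro n
    induction n with
    | zero => intro x hx; simpa using hx
    | succ n ih =>
      intro x hx
      apply distinguished_dvd_of_dvd_sq hA a hu
      have := ih (p * x) (by convert hx using 1; ring)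
      convert this using 1
      ring
  -- Comparing two approximations of `w` shows that `b (n + 1) - p * b (n + 2)` is torsion modulo
  -- `ξ`, so a single factor `p` kills it.
  have hstep : ∀ n, ξ ∣ p * b (n + 1) - p * (p * b (n + 2)) := by
    intro n
    rw [← mul_sub]
    apply tors n
    convert dvd_sub (hb (n + 2)) (hb (n + 1)) using 1
    ring
  choose c hc using hstep
  have hW := hA.isAdicComplete
  obtain ⟨L, hL⟩ := isPrecomplete_span_singleton_iff.1 hW.toIsPrecomplete
    (fun n => ∑ i ∈ Finset.range n, (p : WittVector p A) ^ i * c i) fun n => by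
      rw [Finset.sum_range_succ]
      exact ⟨c n, by ring⟩
  -- Telescoping; in the limit `p * b 1` is `ξ * L`, and `w` is congruent to `p * b 1` modulo `ξ`.
  have hsum : ∀ n, p * b 1 = ξ * ∑ i ∈ Finset.range n, (p : WittVector p A) ^ i * c i +
      (p : WittVector p A) ^ n * (p * b (n + 1)) := by
    intro n
    induction n with
    | zero => simp
    | succ n ih =>
      rw [ih, Finset.sum_range_succ]
      linear_combination (p : WittVector p A) ^ n * hc n
  have hz : p * b 1 = ξ * L := by
    rw [← sub_eq_zero]
    refine isHausdorff_span_singleton_iff.1 hW.toIsHausdorff _ fun n => ?_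
    obtain ⟨d, hd⟩ := hL n
    exact ⟨p * b (n + 1) - ξ * d, by linear_combination hsum n - ξ * hd⟩
  have := hb 1
  rw [pow_one, hz] at this
  exact (dvd_sub_left (dvd_mul_right _ _)).1 this

end Distinguished

/-! ### Coordinates of the tilt in `R / pR`. -/

section Coeff

variable {R : Type u} [CommRing R]

/-- The projection of the tilt to the `n`-th copy of `R / pR`. -/
def tiltCoeff (n : ℕ) : Tilt p R →+* ModP R p :=
  (Pi.evalRingHom (fun _ : ℕ => ModP R p) n).comp (tiltSubring p R).subtype

theorem tilt_ext {x y : Tilt p R} (h : ∀ n, tiltCoeff p n x = tiltCoeff p n y) : x = y :=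
  Subtype.ext (funext h)

theorem tiltCoeff_succ_pow (n : ℕ) (x : Tilt p R) :
    tiltCoeff p (n + 1) x ^ p = tiltCoeff p n x := x.2 n

theorem tiltCoeff_pow_pow (n : ℕ) (x : Tilt p R) :
    tiltCoeff p n x ^ p ^ n = tiltCoeff p 0 x := by
  induction n with
  | zero => simp
  | succ n ih => rw [pow_succ', pow_mul, tiltCoeff_succ_pow, ih]

theorem tiltCoeff_of_pow_pow (n : ℕ) (x : Tilt p R) :
    tiltCoeff p n (x ^ p ^ n) = tiltCoeff p 0 x := by
  rw [map_pow, tiltCoeff_pow_pow]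

theorem tilt_isPerfectOfCharP : IsPerfectOfCharP p (Tilt p R) where
  natCast_eq_zero := tilt_ext p fun n => by
    rw [map_natCast, map_zero, natCast_modP]
  bijective_pow := by
    refine ⟨fun x y hxy => tilt_ext p fun n => ?_, fun x => ?_⟩
    · rw [← tiltCoeff_succ_pow p n x, ← tiltCoeff_succ_pow p n y, ← map_pow, ← map_pow]
      exact congrArg _ hxy
    · refine ⟨⟨fun n => x.1 (n + 1), fun n => x.2 (n + 1)⟩, tilt_ext p fun n => ?_⟩
      exact x.2 n

/-- All coordinates are units, being roots of a unit; uniqueness makes their inverses compatible. -/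
theorem tilt_isUnit_of_tiltCoeff_zero {x : Tilt p R} (h : IsUnit (tiltCoeff p 0 x)) :
    IsUnit x := by
  have hn : ∀ n, IsUnit (tiltCoeff p n x) := fun n =>
    (isUnit_pow_iff (pow_ne_zero n hp.1.ne_zero)).1 (by rwa [tiltCoeff_pow_pow])
  choose y hy using fun n => (hn n).exists_right_inv
  have hc : ∀ n, y (n + 1) ^ p = y n := fun n => by
    have h1 : tiltCoeff p n x * y (n + 1) ^ p = 1 := by
      rw [← tiltCoeff_succ_pow, ← mul_pow, hy, one_pow]
    exact (hn n).mul_left_cancel (h1.trans (hy n).symm)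
  have h1 : x * ⟨y, hc⟩ = 1 := tilt_ext p fun n => by
    rw [map_mul, map_one]
    exact hy n
  exact IsUnit.of_mul_eq_one _ h1

theorem tiltCoeff_surjective (hF : Function.Surjective fun x : ModP R p => x ^ p) (n : ℕ) :
    Function.Surjective (tiltCoeff p n : Tilt p R →+* ModP R p) := by
  intro y
  choose g hg using hF
  have h : ∀ m, g^[m + 1] y ^ p = g^[m] y := fun m => by
    rw [Function.iterate_succ_apply']
    exact hg _
  -- The chosen roots of `y` have zeroth coordinate `y`; the `p ^ n`-th power moves it to place `n`.
  exact ⟨(⟨fun m => g^[m] y, h⟩ : Tilt p R) ^ p ^ n, tiltCoeff_of_pow_pow p n _⟩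

theorem tiltCoeff_tiltMap {S : Type v} [CommRing S] (f : R →+* S) (n : ℕ) (x : Tilt p R) :
    tiltCoeff p n (tiltMap p f x) = modPMap p f (tiltCoeff p n x) := rfl

omit hp in
theorem modPMap_mk {S : Type v} [CommRing S] (f : R →+* S) (x : R) :
    modPMap p f (Ideal.Quotient.mk _ x) = Ideal.Quotient.mk _ (f x) := rfl

omit hp in
theorem modPMap_surjective {S : Type v} [CommRing S] {f : R →+* S} (hf : Function.Surjective f) :
    Function.Surjective (modPMap p f) := by
  intro y
  obtain ⟨z, rfl⟩ := Ideal.Quotient.mk_surjective y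
  obtain ⟨x, rfl⟩ := hf z
  exact ⟨Ideal.Quotient.mk _ x, rfl⟩

omit hp in
theorem modP_mk_eq_zero_iff {x : R} :
    (Ideal.Quotient.mk (Ideal.span {(p : R)}) x : ModP R p) = 0 ↔ (p : R) ∣ x :=
  Ideal.Quotient.eq_zero_iff_mem.trans Ideal.mem_span_singleton

/-- If the first coordinate of `ϖ` vanishes, then the tilt is `ϖ`-adically separated. -/
theorem tilt_eq_zero_of_forall_pow_dvd {ϖ x : Tilt p R} (h : tiltCoeff p 0 ϖ = 0)
    (hx : ∀ n, ϖ ^ n ∣ x) : x = 0 := by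
  refine tilt_ext p fun n => ?_
  obtain ⟨y, rfl⟩ := hx (p ^ n)
  rw [map_mul, tiltCoeff_of_pow_pow, h, zero_mul, map_zero]

/-- Sequences in the tilt that are eventually constant in each copy of `R / pR` converge. -/
theorem exists_tiltCoeff_eq {a : ℕ → Tilt p R}
    (ha : ∀ n, tiltCoeff p n (a (n + 1)) = tiltCoeff p n (a n)) :
    ∃ L : Tilt p R, ∀ n, tiltCoeff p n L = tiltCoeff p n (a n) :=
  ⟨⟨fun n => tiltCoeff p n (a n), fun n => by rw [tiltCoeff_succ_pow, ha]⟩, fun _ => rfl⟩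

end Coeff

/-! ### The sequences `x⁽ⁿ⁾` and Fontaine's map. -/

section Complete

variable {R : Type u} [CommRing R] [IsAdicComplete (Ideal.span {(p : R)}) R]

theorem mk_term (n : ℕ) (x : Tilt p R) :
    (Ideal.Quotient.mk (Ideal.span {(p : R)}) (term p n x) : ModP R p) = tiltCoeff p n x := by
  have h : tiltReduce p R (tiltEquiv p R x) = x :=
    (MulEquiv.ofBijective (tiltReduce p R) (tiltReduce_bijective p R)).apply_symm_apply x
  exact congrArg (tiltCoeff p n) h

theorem term_succ_pow (n : ℕ) (x : Tilt p R) : term p (n + 1) x ^ p = term p n x :=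
  Perfection.coeffMonoidHom_pow_p' _ n

theorem term_mul (n : ℕ) (x y : Tilt p R) : term p n (x * y) = term p n x * term p n y := by
  simp only [term, map_mul]

theorem term_pow (n : ℕ) (x : Tilt p R) (k : ℕ) : term p n (x ^ k) = term p n x ^ k := by
  simp only [term, map_pow]

theorem term_add_pow_pow (m n : ℕ) (x : Tilt p R) : term p (m + n) x ^ p ^ n = term p m x :=
  Perfection.coeffMonoidHom_pow_p_pow' _ m n

theorem term_of_pow_pow (n : ℕ) (x : Tilt p R) : term p n (x ^ p ^ n) = sharp p x := by
  have := term_add_pow_pow p 0 n x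
  rwa [zero_add, ← term_pow] at this

/-- An element of the tilt is determined by any lift of it to a sequence of `p`-th roots. -/
theorem term_eq_of_forall {x : Tilt p R} {y : ℕ → R} (hy : ∀ n, y (n + 1) ^ p = y n)
    (h : ∀ n, (Ideal.Quotient.mk (Ideal.span {(p : R)}) (y n) : ModP R p) = tiltCoeff p n x)
    (n : ℕ) : term p n x = y n := by
  have h1 : tiltReduce p R ⟨y, hy⟩ = x := tilt_ext p h
  have h2 : tiltEquiv p R x = ⟨y, hy⟩ := by
    rw [← h1]
    exact (MulEquiv.ofBijective (tiltReduce p R) (tiltReduce_bijective p R)).symm_apply_apply _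
  rw [term, h2]
  rfl

theorem term_tiltMap {S : Type v} [CommRing S] [IsAdicComplete (Ideal.span {(p : S)}) S]
    (f : R →+* S) (n : ℕ) (x : Tilt p R) : term p n (tiltMap p f x) = f (term p n x) :=
  term_eq_of_forall p (y := fun n => f (term p n x))
    (fun n => by rw [← map_pow, term_succ_pow])
    (fun n => by rw [tiltCoeff_tiltMap, ← mk_term, modPMap_mk]) n

theorem theta_eq_sharp_add (w : WittVector p (Tilt p R)) :
    ∃ w', w = WittVector.teichmuller p (w.coeff 0) + p * w' ∧
      theta p R w = sharp p (w.coeff 0) + p * theta p R w' := by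
  obtain ⟨w', hw⟩ := (tilt_isPerfectOfCharP p).exists_eq_teichmuller_add w
  refine ⟨w', hw, ?_⟩
  rw [← theta_teichmuller]
  nth_rewrite 1 [hw]
  rw [map_add, map_mul, map_natCast]

theorem mk_theta (w : WittVector p (Tilt p R)) :
    (Ideal.Quotient.mk (Ideal.span {(p : R)}) (theta p R w) : ModP R p) =
      tiltCoeff p 0 (w.coeff 0) := by
  obtain ⟨w', -, h⟩ := theta_eq_sharp_add p w
  rw [h, map_add, ← mk_term]
  exact add_eq_left.2 ((modP_mk_eq_zero_iff p).2 (dvd_mul_right _ _))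

/-- Modulo `p`, `θ` is the zeroth coordinate of the zeroth Witt component, which is onto;
completeness of `W` and separatedness of `R` lift this. -/
theorem theta_surjective (hF : Function.Surjective fun x : ModP R p => x ^ p) :
    Function.Surjective (theta p R) := by
  have hW : IsAdicComplete (Ideal.span {(p : WittVector p (Tilt p R))}) _ :=
    (tilt_isPerfectOfCharP p).isAdicComplete
  have hmap : Ideal.map (theta p R) (Ideal.span {(p : WittVector p (Tilt p R))}) =
      Ideal.span {(p : R)} := by
    rw [Ideal.map_span, Set.image_singleton, map_natCast]
  have : IsHausdorff (Ideal.map (theta p R) (Ideal.span {(p : WittVector p (Tilt p R))})) R := by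
    rw [hmap]
    infer_instance
  refine surjective_of_mk_map_comp_surjective (theta p R)
    (I := Ideal.span {(p : WittVector p (Tilt p R))}) ?_
  rw [hmap]
  intro y
  obtain ⟨x, hx⟩ := tiltCoeff_surjective p hF 0 y
  refine ⟨WittVector.teichmuller p x, ?_⟩
  rw [← hx, RingHom.comp_apply]
  refine (mk_theta p _).trans ?_
  rw [WittVector.teichmuller_coeff_zero]

theorem theta_map_tiltMap {S : Type v} [CommRing S] [IsAdicComplete (Ideal.span {(p : S)}) S]
    (f : R →+* S) (w : WittVector p (Tilt p R)) :
    theta p S (WittVector.map (tiltMap p f) w) = f (theta p R w) := by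
  have key : ∀ n (w : WittVector p (Tilt p R)),
      (p : S) ^ n ∣ theta p S (WittVector.map (tiltMap p f) w) - f (theta p R w) := by
    intro n
    induction n with
    | zero => simp
    | succ n ih =>
      intro w
      obtain ⟨w', hw, h⟩ := theta_eq_sharp_add p w
      have h1 : theta p S (WittVector.map (tiltMap p f) w) =
          f (sharp p (w.coeff 0)) + p * theta p S (WittVector.map (tiltMap p f) w') := by
        conv_lhs => rw [hw]
        rw [map_add, map_add, WittVector.map_teichmuller, theta_teichmuller, map_mul, map_mul,
          map_natCast, map_natCast, sharp, term_tiltMap, sharp]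
      obtain ⟨d, hd⟩ := ih w'
      refine ⟨d, ?_⟩
      rw [h, h1, map_add, map_mul, map_natCast]
      linear_combination (p : S) * hd
  rw [← sub_eq_zero]
  exact isHausdorff_span_singleton_iff.1
    (inferInstance : IsHausdorff (Ideal.span {(p : S)}) S) _ fun n => key n w

end Complete

/-! ### Structure of perfectoid rings: `p^♭`, the kernel of `θ`, and the topology of the tilt. -/

section Perfectoid

variable {R : Type u} [CommRing R] [IsAdicComplete (Ideal.span {(p : R)}) R]

theorem dvd_sharp_iff {x : Tilt p R} : (p : R) ∣ sharp p x ↔ tiltCoeff p 0 x = 0 := by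
  rw [← modP_mk_eq_zero_iff, ← mk_term]
  rfl

theorem exists_sharp_eq_add (hF : Function.Surjective fun x : ModP R p => x ^ p) (r : R) :
    ∃ (x : Tilt p R) (t : R), sharp p x = r + p * t := by
  obtain ⟨x, hx⟩ := tiltCoeff_surjective p hF 0 (Ideal.Quotient.mk _ r)
  have h : (Ideal.Quotient.mk (Ideal.span {(p : R)}) (sharp p x - r) : ModP R p) = 0 := by
    rw [map_sub, sub_eq_zero, ← hx]
    exact mk_term p 0 x
  obtain ⟨t, ht⟩ := (modP_mk_eq_zero_iff p).1 h
  exact ⟨x, t, by rw [← ht]; ring⟩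

theorem tiltCoeff_zero_eq_zero_of_sharp {ϖ : Tilt p R} {v : Rˣ} (h : sharp p ϖ = v * (p : R)) :
    tiltCoeff p 0 ϖ = 0 :=
  (dvd_sharp_iff p).1 (h ▸ dvd_mul_left _ _)

/-- With `p = π ^ p * r`, choose `x^♯ = π + pt` and `y^♯ = r + ps`. Then `x^♯` is a unit times `π`,
and `π ^ p * y^♯` is a unit times `p`, so `x ^ p * y` works. -/
theorem IsPerfectoid.exists_sharp_eq (hR : IsPerfectoid p R) :
    ∃ (ϖ : Tilt p R) (v : Rˣ), sharp p ϖ = v * (p : R) := by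
  obtain ⟨π, ⟨r, hr⟩, hπ⟩ := hR.exists_complete
  obtain ⟨x, t, hx⟩ := exists_sharp_eq_add p hR.frobenius_surjective π
  obtain ⟨y, s, hy⟩ := exists_sharp_eq_add p hR.frobenius_surjective r
  obtain ⟨k, hk⟩ := Nat.exists_eq_add_of_le' hp.1.two_le
  have hk' : (p : R) = π ^ (k + 2) * r := by rw [← hk]; exact hr
  have h1 : IsUnit (1 + π ^ (k + 1) * r * t) :=
    isUnit_add_of_dvd isUnit_one (Dvd.intro _ (by ring : π * (π ^ k * r * t) = _))
  have h2 : IsUnit (1 + π ^ (k + 2) * s) :=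
    isUnit_add_of_dvd isUnit_one (Dvd.intro _ (by ring : π * (π ^ (k + 1) * s) = _))
  refine ⟨x ^ p * y, h1.unit ^ p * h2.unit, ?_⟩
  have h3 : sharp p x = π * (1 + π ^ (k + 1) * r * t) := by rw [hx, hk']; ring
  have h4 : π ^ p * sharp p y = (1 + π ^ (k + 2) * s) * p := by
    rw [hy]
    have : π ^ p = π ^ (k + 2) := by rw [hk]
    rw [this]
    linear_combination -hk'
  have h5 : sharp p (x ^ p * y) = sharp p x ^ p * sharp p y := by
    rw [sharp, term_mul, term_pow]
    rfl
  rw [h5, h3, mul_pow, Units.val_mul, Units.val_pow_eq_pow_val, IsUnit.unit_spec,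
    IsUnit.unit_spec]
  linear_combination (1 + π ^ (k + 1) * r * t) ^ p * h4

/-- The kernel of `θ` is generated by a distinguished element `[ϖ] - pu`. -/
theorem IsPerfectoid.exists_ker_theta_eq_span (hR : IsPerfectoid p R) {ϖ : Tilt p R} {v : Rˣ}
    (h : sharp p ϖ = v * (p : R)) : ∃ u : (WittVector p (Tilt p R))ˣ,
      RingHom.ker (theta p R) = Ideal.span {WittVector.teichmuller p ϖ - p * u} := by
  have hA : IsPerfectOfCharP p (Tilt p R) := tilt_isPerfectOfCharP p
  obtain ⟨u, hu⟩ := theta_surjective p hR.frobenius_surjective (v : R)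
  have hu0 : IsUnit (u.coeff 0) := by
    apply tilt_isUnit_of_tiltCoeff_zero
    rw [← mk_theta, hu]
    exact v.isUnit.map _
  refine ⟨(hA.isUnit_of_coeff_zero hu0).unit, ?_⟩
  rw [IsUnit.unit_spec]
  obtain ⟨ξ, hξ⟩ := hR.ker_theta_principal
  rw [Ideal.submodule_span_eq] at hξ
  have hmem : WittVector.teichmuller p ϖ - p * u ∈ RingHom.ker (theta p R) := by
    rw [RingHom.mem_ker, map_sub, map_mul, map_natCast, theta_teichmuller, h, hu]
    ring
  have hξ0 : tiltCoeff p 0 (ξ.coeff 0) = 0 := by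
    have : theta p R ξ = 0 := by
      rw [← RingHom.mem_ker]
      exact hξ ▸ Ideal.mem_span_singleton_self ξ
    rw [← mk_theta, this, map_zero]
  have hmem' : WittVector.teichmuller p ϖ - p * u ∈ Ideal.span {ξ} := hξ ▸ hmem
  obtain ⟨a, ha⟩ := Ideal.mem_span_singleton.1 hmem'
  obtain ⟨a', ha'⟩ := hA.exists_eq_teichmuller_add a
  obtain ⟨ξ', hξ'⟩ := hA.exists_eq_teichmuller_add ξ
  have h0 : ϖ = ξ.coeff 0 * a.coeff 0 := by
    have := congrArg (fun w => w.coeff 0) ha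
    simp only [coeff_zero_sub, coeff_zero_mul, WittVector.teichmuller_coeff_zero] at this
    rw [← coeff_zero_mul, hA.coeff_zero_natCast_mul, sub_zero] at this
    exact this
  have hT : WittVector.teichmuller p ϖ =
      WittVector.teichmuller p (ξ.coeff 0) * WittVector.teichmuller p (a.coeff 0) := by
    rw [← map_mul, ← h0]
  -- With `[ϖ] - pu = ξ * a`, comparing the terms divisible by `p` shows that `a` is a unit: the
  -- zeroth component of `ξ` vanishes in `R / pR`, whereas `u` is a unit.
  have h1 : -u = WittVector.teichmuller p (ξ.coeff 0) * a' + ξ' * a := by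
    apply hA.natCast_mul_cancel
    linear_combination ha - hT + WittVector.teichmuller p (ξ.coeff 0) * ha' + a * hξ'
  have h2 : -u.coeff 0 = ξ.coeff 0 * a'.coeff 0 + ξ'.coeff 0 * a.coeff 0 := by
    have := congrArg (fun w => w.coeff 0) h1
    simpa only [coeff_zero_neg, coeff_zero_add, coeff_zero_mul,
      WittVector.teichmuller_coeff_zero] using this
  have h3 : IsUnit (a.coeff 0) := by
    apply tilt_isUnit_of_tiltCoeff_zero
    have := congrArg (tiltCoeff p 0) h2
    rw [map_add, map_mul, hξ0, zero_mul, zero_add, map_mul] at this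
    exact isUnit_of_mul_isUnit_right (this ▸ hu0.neg.map _)
  have h4 : RingHom.ker (theta p R) = Ideal.span {ξ} := hξ
  rw [h4, ha]
  exact (Ideal.span_singleton_mul_right_unit (hA.isUnit_of_coeff_zero h3) ξ).symm

/-- If `x^♯ = p * θ(w)`, then `[x] - pw` is a multiple of `[ϖ] - pu`; reduce modulo `p`. -/
theorem IsPerfectoid.dvd_of_tiltCoeff_zero (hR : IsPerfectoid p R) {ϖ : Tilt p R} {v : Rˣ}
    (h : sharp p ϖ = v * (p : R)) {x : Tilt p R} (hx : tiltCoeff p 0 x = 0) : ϖ ∣ x := by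
  obtain ⟨u, hu⟩ := hR.exists_ker_theta_eq_span p h
  obtain ⟨r, hr⟩ := (dvd_sharp_iff p).2 hx
  obtain ⟨w, rfl⟩ := theta_surjective p hR.frobenius_surjective r
  have hmem : WittVector.teichmuller p x - p * w ∈ RingHom.ker (theta p R) := by
    rw [RingHom.mem_ker, map_sub, map_mul, map_natCast, theta_teichmuller, hr, sub_self]
  rw [hu, Ideal.mem_span_singleton] at hmem
  have := map_dvd (WittVector.constantCoeff (p := p) (R := Tilt p R)) hmem
  simp only [map_sub, map_mul, map_natCast, (tilt_isPerfectOfCharP p).natCast_eq_zero, zero_mul,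
    sub_zero, WittVector.constantCoeff_apply, WittVector.teichmuller_coeff_zero] at this
  exact this

theorem IsPerfectoid.pow_dvd_of_tiltCoeff (hR : IsPerfectoid p R) {ϖ : Tilt p R} {v : Rˣ}
    (h : sharp p ϖ = v * (p : R)) {n : ℕ} {x : Tilt p R} (hx : tiltCoeff p n x = 0) :
    ϖ ^ p ^ n ∣ x := by
  obtain ⟨y, rfl⟩ := ((tilt_isPerfectOfCharP p).bijective_pow_pow n).2 x
  simp only [tiltCoeff_of_pow_pow] at hx
  exact pow_dvd_pow_of_dvd (hR.dvd_of_tiltCoeff_zero p h hx) _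

theorem IsPerfectoid.isPrecomplete_tilt (hR : IsPerfectoid p R) {ϖ : Tilt p R} {v : Rˣ}
    (h : sharp p ϖ = v * (p : R)) : IsPrecomplete (Ideal.span {ϖ}) (Tilt p R) := by
  refine isPrecomplete_span_singleton_iff.2 fun f hf => ?_
  have h0 := tiltCoeff_zero_eq_zero_of_sharp p h
  -- Coordinate `n` kills `ϖ ^ p ^ n`, so it is constant along `f` from the index `p ^ n` on.
  obtain ⟨L, hL⟩ := exists_tiltCoeff_eq p (a := fun n => f (p ^ n)) fun n => by
    obtain ⟨d, hd⟩ := pow_dvd_sub_of_le hf (Nat.pow_le_pow_right hp.1.pos n.le_succ)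
    rw [← sub_eq_zero, ← map_sub, hd, map_mul, tiltCoeff_of_pow_pow, h0, zero_mul]
  refine ⟨L, fun n => ?_⟩
  have hn : n ≤ p ^ n := (Nat.lt_pow_self hp.1.one_lt).le
  rw [← sub_add_sub_cancel L (f (p ^ n))]
  refine dvd_add ((pow_dvd_pow ϖ hn).trans (hR.pow_dvd_of_tiltCoeff p h ?_))
    (pow_dvd_sub_of_le hf hn)
  rw [map_sub, sub_eq_zero]
  exact hL n

end Perfectoid

/-- Perfect rings of characteristic `p` are perfectoid. -/
theorem IsPerfectOfCharP.isPerfectoid {B : Type u} [CommRing B] (hB : IsPerfectOfCharP p B) :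
    IsPerfectoid p B := by
  have h0 := hB.natCast_eq_zero
  have hbot : Ideal.span {(0 : B)} = ⊥ := Ideal.span_singleton_eq_bot.2 rfl
  have hc : IsAdicComplete (Ideal.span {(0 : B)}) B := by
    rw [hbot]
    exact {}
  have hcp : IsAdicComplete (Ideal.span {(p : B)}) B := by rwa [h0]
  refine ⟨⟨0, by rw [h0, zero_pow hp.1.ne_zero], hc⟩, fun x => ?_, ⟨(p : WittVector p (Tilt p B)), ?_⟩⟩
  · obtain ⟨y, rfl⟩ := Ideal.Quotient.mk_surjective x
    obtain ⟨z, rfl⟩ := hB.bijective_pow.2 y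
    exact ⟨Ideal.Quotient.mk _ z, (map_pow _ z p).symm⟩
  · rw [Ideal.submodule_span_eq]
    ext w
    rw [RingHom.mem_ker, Ideal.mem_span_singleton]
    constructor
    · intro hw
      rw [(tilt_isPerfectOfCharP p).natCast_dvd_iff]
      have h1 : tiltCoeff p 0 (w.coeff 0) = 0 := by rw [← mk_theta, hw, map_zero]
      refine tilt_ext p fun n => ?_
      rw [map_zero, ← mk_term, modP_mk_eq_zero_iff, h0, zero_dvd_iff]
      -- As `p = 0` in `B`, the element `x⁽⁰⁾` itself vanishes, hence so do its roots `x⁽ⁿ⁾`.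
      apply hB.eq_zero_of_pow_eq_zero (n := n)
      have := term_add_pow_pow p 0 n (w.coeff 0)
      rw [zero_add] at this
      rw [this]
      have := (dvd_sharp_iff p).2 h1
      rwa [h0, zero_dvd_iff] at this
    · rintro ⟨w', rfl⟩
      rw [map_mul, map_natCast]
      exact mul_eq_zero_of_left h0 _

/-! ### Kernel and image of the tilted quotient map. -/

variable {R : Type u} [CommRing R]

omit hp in
theorem isAdicallyClosed_of_isHausdorff_quotient {J : Ideal R}
    (h : IsHausdorff (Ideal.span {(p : R ⧸ J)}) (R ⧸ J)) : IsAdicallyClosed (p : R) J := by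
  refine isAdicallyClosed_iff.2 fun x hx => Ideal.Quotient.eq_zero_iff_mem.1 ?_
  refine isHausdorff_span_singleton_iff.1 h _ fun n => ?_
  obtain ⟨y, hy, hd⟩ := hx n
  have := map_dvd (Ideal.Quotient.mk J) hd
  rwa [map_pow, map_natCast, map_sub, Ideal.Quotient.eq_zero_iff_mem.2 hy, sub_zero] at this

theorem tilt_subset_ker [IsAdicComplete (Ideal.span {(p : R)}) R] (J : Ideal R) :
    tilt p (J : Set R) ⊆ RingHom.ker (tiltMap p (Ideal.Quotient.mk J)) := by
  intro x hx
  refine (RingHom.mem_ker).2 (tilt_ext p fun n => ?_)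
  rw [tiltCoeff_tiltMap, ← mk_term, modPMap_mk, Ideal.Quotient.eq_zero_iff_mem.2 (hx n), map_zero,
    map_zero]

theorem tilt_eq_ker_tiltMap [IsAdicComplete (Ideal.span {(p : R)}) R] {J : Ideal R}
    (hJ : IsAdicallyClosed (p : R) J) :
    tilt p (J : Set R) = (RingHom.ker (tiltMap p (Ideal.Quotient.mk J)) : Set (Tilt p R)) := by
  refine (tilt_subset_ker p J).antisymm fun x hx n => ?_
  refine isAdicallyClosed_iff.1 hJ _ fun k => ?_
  have h1 : tiltCoeff p (n + k) (tiltMap p (Ideal.Quotient.mk J) x) = 0 := by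
    rw [(RingHom.mem_ker).1 hx, map_zero]
  rw [tiltCoeff_tiltMap, ← mk_term, modPMap_mk, modP_mk_eq_zero_iff] at h1
  have h2 := pow_dvd_pow_of_dvd h1 (p ^ k)
  rw [← map_pow, term_add_pow_pow] at h2
  obtain ⟨c, hc⟩ := (pow_dvd_pow _ (Nat.lt_pow_self hp.1.one_lt).le).trans h2
  obtain ⟨c, rfl⟩ := Ideal.Quotient.mk_surjective c
  refine ⟨term p n x - p ^ k * c, Ideal.Quotient.eq_zero_iff_mem.1 ?_, c, by ring⟩
  rw [map_sub, hc, map_mul, map_pow, map_natCast, sub_self]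

theorem sharp_tiltMap {S : Type v} [CommRing S] [IsAdicComplete (Ideal.span {(p : R)}) R]
    [IsAdicComplete (Ideal.span {(p : S)}) S] (f : R →+* S) {ϖ : Tilt p R} {v : Rˣ}
    (h : sharp p ϖ = v * (p : R)) :
    sharp p (tiltMap p f ϖ) = (Units.map (f : R →* S) v : Sˣ) * (p : S) := by
  rw [sharp, term_tiltMap]
  have := congrArg f h
  rw [map_mul, map_natCast] at this
  exact this

/-- The tilt of a surjection of perfectoid rings is surjective. -/
theorem tiltMap_surjective {S : Type v} [CommRing S] (hR : IsPerfectoid p R)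
    (hS : IsPerfectoid p S) {f : R →+* S} (hf : Function.Surjective f) :
    Function.Surjective (tiltMap p f) := by
  have := hR.complete
  have := hS.complete
  obtain ⟨ϖ, v, h⟩ := hR.exists_sharp_eq
  have h' := sharp_tiltMap p f h
  have h0 := tiltCoeff_zero_eq_zero_of_sharp p h'
  have : IsPrecomplete (Ideal.span {ϖ}) (Tilt p R) := hR.isPrecomplete_tilt p h
  have hmap : Ideal.map (tiltMap p f) (Ideal.span {ϖ}) = Ideal.span {tiltMap p f ϖ} := by
    rw [Ideal.map_span, Set.image_singleton]
  have : IsHausdorff (Ideal.map (tiltMap p f) (Ideal.span {ϖ})) (Tilt p S) := by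
    rw [hmap]
    exact isHausdorff_span_singleton_iff.2 fun x hx => tilt_eq_zero_of_forall_pow_dvd p h0 hx
  -- By completeness it suffices to be onto modulo `ϖ`, where the tilt of `S` embeds in `S / pS`.
  refine surjective_of_mk_map_comp_surjective (tiltMap p f) (I := Ideal.span {ϖ}) fun y => ?_
  obtain ⟨y, rfl⟩ := Ideal.Quotient.mk_surjective y
  obtain ⟨z, hz⟩ := modPMap_surjective p hf (tiltCoeff p 0 y)
  obtain ⟨x, rfl⟩ := tiltCoeff_surjective p hR.frobenius_surjective 0 z
  refine ⟨x, ?_⟩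
  rw [RingHom.comp_apply, Ideal.Quotient.eq, hmap, Ideal.mem_span_singleton]
  refine hS.dvd_of_tiltCoeff_zero p h' ?_
  rw [map_sub, tiltCoeff_tiltMap, hz, sub_self]

theorem ker_tiltMap_isRadical {S : Type v} [CommRing S] (f : R →+* S) :
    (RingHom.ker (tiltMap p f)).IsRadical := by
  rintro x ⟨n, hn⟩
  rw [RingHom.mem_ker, map_pow] at hn
  rw [RingHom.mem_ker]
  exact (tilt_isPerfectOfCharP p).eq_zero_of_pow_eq_zero (n := n)
    (pow_eq_zero_of_le (Nat.lt_pow_self hp.1.one_lt).le hn)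

theorem ker_tiltMap_isAdicallyClosed {S : Type v} [CommRing S] (f : R →+* S) {ϖ : Tilt p R}
    (h : tiltCoeff p 0 ϖ = 0) : IsAdicallyClosed ϖ (RingHom.ker (tiltMap p f)) := by
  refine isAdicallyClosed_iff.2 fun x hx => (RingHom.mem_ker).2 ?_
  have h0 : tiltCoeff p 0 (tiltMap p f ϖ) = 0 := by rw [tiltCoeff_tiltMap, h, map_zero]
  refine tilt_eq_zero_of_forall_pow_dvd p h0 fun n => ?_
  obtain ⟨y, hy, hd⟩ := hx n
  have := map_dvd (tiltMap p f) hd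
  rwa [map_pow, map_sub, (RingHom.mem_ker).1 hy, sub_zero] at this

/-! ### The untilt of a radical ideal. -/

section Untilt

variable [IsAdicComplete (Ideal.span {(p : R)}) R]

/-- The untilt `θ(W(I))` of a radical ideal `I`, as an ideal. -/
def untiltIdeal (I : Ideal (Tilt p R)) : Ideal R :=
  Ideal.map (theta p R) (RingHom.ker (WittVector.map (p := p) (Ideal.Quotient.mk I)))

variable {p}
variable (hR : IsPerfectoid p R) {I : Ideal (Tilt p R)} (hI : I.IsRadical)

include hR in
theorem mem_untiltIdeal_iff {r : R} : r ∈ untiltIdeal p I ↔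
    ∃ w, WittVector.map (p := p) (Ideal.Quotient.mk I) w = 0 ∧ theta p R w = r :=
  Ideal.mem_map_iff_of_surjective _ (theta_surjective p hR.frobenius_surjective)

include hR hI in
theorem coe_untiltIdeal : (untiltIdeal p I : Set R) = untilt p (I : Set (Tilt p R)) := by
  ext r
  rw [SetLike.mem_coe, mem_untiltIdeal_iff hR, untilt,
    wittSet_eq_ker p (tilt_isPerfectOfCharP p) hI]
  rfl

include hR in
-- This encodes `R / I^♯ = W(A / I) / ([ϖ] - pu)`, where `A` is the tilt of `R`.
theorem theta_mem_untiltIdeal_iff {ϖ : Tilt p R} {u : WittVector p (Tilt p R)}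
    (hu : RingHom.ker (theta p R) = Ideal.span {WittVector.teichmuller p ϖ - p * u})
    {w : WittVector p (Tilt p R)} : theta p R w ∈ untiltIdeal p I ↔
      WittVector.teichmuller p (Ideal.Quotient.mk I ϖ) -
        p * WittVector.map (Ideal.Quotient.mk I) u ∣ WittVector.map (Ideal.Quotient.mk I) w := by
  rw [mem_untiltIdeal_iff hR]
  constructor
  · rintro ⟨w', hw', h⟩
    have hmem : w - w' ∈ RingHom.ker (theta p R) := by
      rw [RingHom.mem_ker, map_sub, h, sub_self]
    rw [hu, Ideal.mem_span_singleton] at hmem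
    have := map_dvd (WittVector.map (p := p) (Ideal.Quotient.mk I)) hmem
    rwa [map_sub, map_sub, hw', sub_zero, map_mul, map_natCast, WittVector.map_teichmuller] at this
  · rintro ⟨c, hc⟩
    obtain ⟨c, rfl⟩ := WittVector.map_surjective _ Ideal.Quotient.mk_surjective c
    refine ⟨w - (WittVector.teichmuller p ϖ - p * u) * c, ?_, ?_⟩
    · rw [map_sub, hc, map_mul, map_sub, map_mul, map_natCast, WittVector.map_teichmuller, sub_self]
    · have : theta p R (WittVector.teichmuller p ϖ - p * u) = 0 := by
        rw [← RingHom.mem_ker, hu]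
        exact Ideal.mem_span_singleton_self _
      rw [map_sub, map_mul, this, zero_mul, sub_zero]

include hR hI in
theorem untiltIdeal_quotient_isAdicComplete :
    IsAdicComplete (Ideal.span {(p : R ⧸ untiltIdeal p I)}) (R ⧸ untiltIdeal p I) := by
  obtain ⟨ϖ, v, h⟩ := hR.exists_sharp_eq
  obtain ⟨u, hu⟩ := hR.exists_ker_theta_eq_span p h
  have hB := (tilt_isPerfectOfCharP p).quotient hI
  refine @IsAdicComplete.mk _ _ _ _ _ _ (isHausdorff_span_singleton_iff.2 fun x hx => ?_) ?_
  · obtain ⟨r, rfl⟩ := Ideal.Quotient.mk_surjective x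
    obtain ⟨w, rfl⟩ := theta_surjective p hR.frobenius_surjective r
    rw [Ideal.Quotient.eq_zero_iff_mem, theta_mem_untiltIdeal_iff hR hu]
    refine distinguished_dvd_of_forall hB _
      (u.isUnit.map (WittVector.map (p := p) (Ideal.Quotient.mk I))) fun n => ?_
    obtain ⟨y, hy⟩ := hx n
    obtain ⟨s, rfl⟩ := Ideal.Quotient.mk_surjective y
    obtain ⟨b, rfl⟩ := theta_surjective p hR.frobenius_surjective s
    refine ⟨WittVector.map (Ideal.Quotient.mk I) b, ?_⟩
    have hmem : theta p R (w - p ^ n * b) ∈ untiltIdeal p I := by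
      rw [← Ideal.Quotient.eq_zero_iff_mem, map_sub, map_mul, map_pow, map_natCast, map_sub, hy,
        map_mul, map_pow, map_natCast, sub_self]
    rw [theta_mem_untiltIdeal_iff hR hu, map_sub, map_mul, map_pow, map_natCast] at hmem
    exact hmem
  · have := isPrecomplete_of_surjective
      (Ideal.Quotient.mk_surjective (I := untiltIdeal p I)) (a := (p : R)) inferInstance
    rwa [map_natCast] at this

include hR hI in
theorem le_ker_tiltMap_untiltIdeal :
    I ≤ RingHom.ker (tiltMap p (Ideal.Quotient.mk (untiltIdeal p I))) := by
  intro x hx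
  apply tilt_subset_ker
  intro n
  obtain ⟨y, rfl⟩ := ((tilt_isPerfectOfCharP p).bijective_pow_pow n).2 x
  -- Radicality puts the `p ^ n`-th root `y` of `x` in `I`, and `x⁽ⁿ⁾ = y^♯ = θ([y])`.
  have hy : y ∈ I := hI ⟨_, hx⟩
  simp only [term_of_pow_pow]
  rw [SetLike.mem_coe, mem_untiltIdeal_iff hR]
  refine ⟨WittVector.teichmuller p y, ?_, theta_teichmuller p R y⟩
  rw [WittVector.map_teichmuller, Ideal.Quotient.eq_zero_iff_mem.2 hy, WittVector.teichmuller_zero]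

include hR in
-- Here `x^♯` is `θ(w)` modulo `p` with `w` in `W(I)`, so `x` agrees with the leading component of
-- `w` modulo `ϖ`.
theorem exists_dvd_sub_of_tiltCoeff_tiltMap_zero {ϖ : Tilt p R} {v : Rˣ}
    (h : sharp p ϖ = v * (p : R)) {x : Tilt p R}
    (hx : tiltCoeff p 0 (tiltMap p (Ideal.Quotient.mk (untiltIdeal p I)) x) = 0) :
    ∃ y ∈ I, ϖ ∣ x - y := by
  rw [tiltCoeff_tiltMap, ← mk_term, modPMap_mk, modP_mk_eq_zero_iff] at hx
  obtain ⟨c, hc⟩ := hx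
  obtain ⟨c, rfl⟩ := Ideal.Quotient.mk_surjective c
  have hmem : sharp p x - p * c ∈ untiltIdeal p I := by
    rw [← Ideal.Quotient.eq_zero_iff_mem, map_sub, map_mul, map_natCast, ← hc]
    exact sub_self _
  obtain ⟨w, hw, hwc⟩ := (mem_untiltIdeal_iff hR).1 hmem
  have hw0 : w.coeff 0 ∈ I := by
    have := congrArg (fun z => z.coeff 0) hw
    simp only [WittVector.map_coeff, WittVector.zero_coeff] at this
    exact Ideal.Quotient.eq_zero_iff_mem.1 this
  refine ⟨w.coeff 0, hw0, hR.dvd_of_tiltCoeff_zero p h ?_⟩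
  rw [map_sub, ← mk_theta, hwc, ← mk_term, ← map_sub, modP_mk_eq_zero_iff]
  exact ⟨c, by rw [sharp]; ring⟩

include hR in
theorem exists_pow_dvd_sub_of_tiltCoeff_tiltMap_zero {ϖ : Tilt p R} {v : Rˣ}
    (h : sharp p ϖ = v * (p : R)) {n : ℕ} {x : Tilt p R}
    (hx : tiltCoeff p n (tiltMap p (Ideal.Quotient.mk (untiltIdeal p I)) x) = 0) :
    ∃ y ∈ I, ϖ ^ p ^ n ∣ x - y := by
  have hA : IsPerfectOfCharP p (Tilt p R) := tilt_isPerfectOfCharP p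
  obtain ⟨z, rfl⟩ := (hA.bijective_pow_pow n).2 x
  rw [map_pow, tiltCoeff_of_pow_pow] at hx
  obtain ⟨y, hy, hd⟩ := exists_dvd_sub_of_tiltCoeff_tiltMap_zero hR h hx
  refine ⟨y ^ p ^ n, Ideal.pow_mem_of_mem I hy _ (pow_pos hp.1.pos n), ?_⟩
  have hsub : (z - y) ^ p ^ n = z ^ p ^ n - y ^ p ^ n := by
    rcases hA.subsingleton_or with _ | ⟨_, _⟩
    · exact Subsingleton.elim _ _
    · exact sub_pow_char_pow z y n
  rw [← hsub]
  exact pow_dvd_pow_of_dvd hd _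

include hR hI in
-- `tiltMap_surjective` does not apply, as `R / I^♯` is not yet known to be perfectoid. Lifts of the
-- coordinates are instead corrected by elements of `I`, which die in the target, until they
-- converge.
theorem tiltMap_untiltIdeal_surjective :
    Function.Surjective (tiltMap p (Ideal.Quotient.mk (untiltIdeal p I))) := by
  obtain ⟨ϖ, v, h⟩ := hR.exists_sharp_eq
  set f := tiltMap p (Ideal.Quotient.mk (untiltIdeal p I)) with hf
  intro y
  have hlift : ∀ n, ∃ a : Tilt p R, tiltCoeff p n (f a) = tiltCoeff p n y := fun n => by
    obtain ⟨z, hz⟩ := modPMap_surjective p (Ideal.Quotient.mk_surjective (I := untiltIdeal p I))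
      (tiltCoeff p n y)
    obtain ⟨a, rfl⟩ := tiltCoeff_surjective p hR.frobenius_surjective n z
    exact ⟨a, hz⟩
  have hstep : ∀ n (a : Tilt p R), tiltCoeff p n (f a) = tiltCoeff p n y →
      ∃ b, tiltCoeff p (n + 1) (f b) = tiltCoeff p (n + 1) y ∧
        tiltCoeff p n b = tiltCoeff p n a := by
    intro n a ha
    obtain ⟨b, hb⟩ := hlift (n + 1)
    have hab : tiltCoeff p n (f (b - a)) = 0 := by
      rw [map_sub, map_sub, ha, ← tiltCoeff_succ_pow, hb, tiltCoeff_succ_pow, sub_self]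
    obtain ⟨c, hc, d, hd⟩ := exists_pow_dvd_sub_of_tiltCoeff_tiltMap_zero hR h hab
    refine ⟨b - c, ?_, ?_⟩
    · rw [map_sub, (RingHom.mem_ker).1 (le_ker_tiltMap_untiltIdeal hR hI hc), sub_zero, hb]
    · rw [← sub_eq_zero, ← map_sub, sub_right_comm, hd, map_mul, tiltCoeff_of_pow_pow,
        tiltCoeff_zero_eq_zero_of_sharp p h, zero_mul]
  choose g hg1 hg2 using hstep
  obtain ⟨a0, ha0⟩ := hlift 0
  let a : ∀ n, {a : Tilt p R // tiltCoeff p n (f a) = tiltCoeff p n y} := fun n =>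
    Nat.rec ⟨a0, ha0⟩ (fun n a => ⟨g n a.1 a.2, hg1 n a.1 a.2⟩) n
  obtain ⟨L, hL⟩ := exists_tiltCoeff_eq p (a := fun n => (a n).1) fun n => hg2 n (a n).1 (a n).2
  refine ⟨L, tilt_ext p fun n => ?_⟩
  rw [hf, tiltCoeff_tiltMap, hL, ← tiltCoeff_tiltMap]
  exact (a n).2

include hR hI in
theorem untiltIdeal_isPerfectoidIdeal : IsPerfectoidIdeal p (untiltIdeal p I) := by
  obtain ⟨ϖ, v, h⟩ := hR.exists_sharp_eq
  obtain ⟨u, hu⟩ := hR.exists_ker_theta_eq_span p h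
  have hS := untiltIdeal_quotient_isAdicComplete hR hI
  set q := Ideal.Quotient.mk (untiltIdeal p I) with hq
  -- The image of `ϖ⁽¹⁾`, a `p`-th root of a unit multiple of `p`, serves as `π`.
  have hπ : q (term p 1 ϖ) ^ p = (Units.map (q : R →* _) v : (R ⧸ untiltIdeal p I)ˣ) * p := by
    rw [← map_pow, term_succ_pow, ← sharp, h, map_mul, map_natCast]
    rfl
  refine ⟨⟨q (term p 1 ϖ), ?_, isAdicComplete_of_pow_eq hp.1.ne_zero _ hπ hS⟩, fun x => ?_, ?_⟩
  · rw [hπ, (Units.isUnit _).mul_left_dvd]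
  · obtain ⟨y, rfl⟩ := modPMap_surjective p (Ideal.Quotient.mk_surjective (I := untiltIdeal p I)) x
    obtain ⟨z, rfl⟩ := hR.frobenius_surjective y
    exact ⟨modPMap p q z, (map_pow _ z p).symm⟩
  · set F := WittVector.map (p := p) (tiltMap p q) with hF
    refine ⟨F (WittVector.teichmuller p ϖ - p * u), ?_⟩
    rw [Ideal.submodule_span_eq]
    ext z
    obtain ⟨w, rfl⟩ := WittVector.map_surjective _ (tiltMap_untiltIdeal_surjective hR hI) z
    rw [RingHom.mem_ker, theta_map_tiltMap, Ideal.Quotient.eq_zero_iff_mem, mem_untiltIdeal_iff hR,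
      Ideal.mem_span_singleton]
    constructor
    · rintro ⟨w', hw', hww'⟩
      have hmem : w - w' ∈ RingHom.ker (theta p R) := by
        rw [RingHom.mem_ker, map_sub, hww', sub_self]
      rw [hu, Ideal.mem_span_singleton] at hmem
      -- `F` kills `W(I)`, so only the multiple of `[ϖ] - pu` survives.
      have h0 : F w' = 0 := by
        refine WittVector.ext fun n => ?_
        have := congrArg (fun z => z.coeff n) hw'
        simp only [WittVector.map_coeff, WittVector.zero_coeff] at this
        rw [hF, WittVector.map_coeff, WittVector.zero_coeff]
        exact le_ker_tiltMap_untiltIdeal hR hI (Ideal.Quotient.eq_zero_iff_mem.1 this)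
      have := map_dvd F hmem
      rwa [map_sub F w w', h0, sub_zero] at this
    · intro hd
      rw [← mem_untiltIdeal_iff hR, ← Ideal.Quotient.eq_zero_iff_mem, ← theta_map_tiltMap]
      obtain ⟨c, hc⟩ := hd
      have h0 : theta p R (WittVector.teichmuller p ϖ - p * u) = 0 := by
        rw [← RingHom.mem_ker, hu]
        exact Ideal.mem_span_singleton_self _
      change theta p _ (F w) = 0
      rw [hc, map_mul, hF, theta_map_tiltMap, h0, map_zero, zero_mul]

end Untilt

end

end Perfd


theorem lemma3 (p : ℕ) [Fact p.Prime] (R : Type*) [CommRing R]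
    [IsAdicComplete (Ideal.span {(p : R)}) R] :
    -- `J^♭ = ker φ^♭` for a `p`-adically closed ideal `J`
    (∀ J : Ideal R, Perfd.IsAdicallyClosed (p : R) J →
      Perfd.tilt p (J : Set R) =
        (RingHom.ker (Perfd.tiltMap p (Ideal.Quotient.mk J)) : Set (Perfd.Tilt p R))) ∧
    -- `φ^♭` induces an isomorphism from the quotient by `J^♭` to the tilt of the quotient by `J`
    (Perfd.IsPerfectoid p R → CharZero R → ∀ J : Ideal R, Perfd.IsPerfectoidIdeal p J →
      ∃ I : Ideal (Perfd.Tilt p R), (I : Set (Perfd.Tilt p R)) = Perfd.tilt p (J : Set R) ∧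
        ∃ e : (Perfd.Tilt p R ⧸ I) ≃+* Perfd.Tilt p (R ⧸ J),
          ∀ x : Perfd.Tilt p R,
            e (Ideal.Quotient.mk I x) = Perfd.tiltMap p (Ideal.Quotient.mk J) x) ∧
    -- `J^♭` is a `p^♭`-adically closed radical ideal
    (Perfd.IsPerfectoid p R → ∀ pflat : Perfd.Tilt p R,
      (∃ v : Rˣ, Perfd.sharp p pflat = v * (p : R)) →
      ∀ J : Ideal R, Perfd.IsPerfectoidIdeal p J →
        ∃ I : Ideal (Perfd.Tilt p R), (I : Set (Perfd.Tilt p R)) = Perfd.tilt p (J : Set R) ∧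
          Perfd.IsAdicallyClosed pflat I ∧ I.IsRadical) ∧
    -- the untilt of a `p^♭`-adically closed radical (hence perfectoid) ideal is perfectoid
    (Perfd.IsPerfectoid p R → CharZero R → ∀ pflat : Perfd.Tilt p R,
      (∃ v : Rˣ, Perfd.sharp p pflat = v * (p : R)) →
      ∀ I : Ideal (Perfd.Tilt p R), Perfd.IsAdicallyClosed pflat I → I.IsRadical →
        Perfd.IsPerfectoidIdeal p I ∧
        ∃ K : Ideal R, (K : Set R) = Perfd.untilt p (I : Set (Perfd.Tilt p R)) ∧
          Perfd.IsPerfectoidIdeal p K) := by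
  have hclosed : ∀ J : Ideal R, Perfd.IsPerfectoidIdeal p J → Perfd.IsAdicallyClosed (p : R) J :=
    fun J hJ => Perfd.isAdicallyClosed_of_isHausdorff_quotient p hJ.complete.toIsHausdorff
  refine ⟨fun J hJ => Perfd.tilt_eq_ker_tiltMap p hJ, fun hR _ J hJ => ?_,
    fun hR pflat hpflat J hJ => ?_, fun hR _ pflat _ I _ hI => ?_⟩
  · refine ⟨_, (Perfd.tilt_eq_ker_tiltMap p (hclosed J hJ)).symm,
      RingHom.quotientKerEquivOfSurjective
        (Perfd.tiltMap_surjective p hR hJ Ideal.Quotient.mk_surjective), fun x => rfl⟩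
  · obtain ⟨v, hv⟩ := hpflat
    exact ⟨_, (Perfd.tilt_eq_ker_tiltMap p (hclosed J hJ)).symm,
      Perfd.ker_tiltMap_isAdicallyClosed p _ (Perfd.tiltCoeff_zero_eq_zero_of_sharp p hv),
      Perfd.ker_tiltMap_isRadical p _⟩
  · exact ⟨((Perfd.tilt_isPerfectOfCharP p).quotient hI).isPerfectoid,
      Perfd.untiltIdeal p I, Perfd.coe_untiltIdeal hR hI,
      Perfd.untiltIdeal_isPerfectoidIdeal hR hI⟩
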